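/- For $u>0$ let $\zeta(s,u)$ be the Hurwitz zeta function, i.e. the meromorphic continuation to $\mathbb C$ of $\sum_{n\ge 0}(n+u)^{-s}$ ($\operatorname{Re}s>1$), and define the generalised Stieltjes constants $\gamma_p(u)$, $p\ge 0$, by the Laurent expansion $$\zeta(s,u)=\frac1{s-1}+\sum_{p=0}^{\infty}\frac{(-1)^p}{p!}\,\gamma_p(u)\,(s-1)^p ,\qquad \gamma_p:=\gamma_p(1).$$ Let $\psi=\Gamma'/\Gamma$ be the digamma function, and let $Y_k$ be the (exponential) complete Bell polynomials: $Y_0=1$ and, for $k\ge1$, $$Y_k(x_1,\dots,x_k)=\sum \frac{k!}{k_1!\cdots k_k!}\Big(\frac{x_1}{1!}\Big)^{k_1}\cdots\Big(\frac{x_k}{k!}\Big)^{k_k},$$ where the sum runs over all non-negative integers $k_1,\dots,k_k$ with $k_1+2k_2+\dots+kk_k=k$. All integrals below converge absolutely, zeroth powers of logarithms are read as $1$, and the following hold. (a) For every integer $n\ge1$ and every real $u>0$, $$\gamma_{n-1}(u)=\frac1{2u}\log^{n-1}u-\frac1n\log^n u+(-1)^{n-1}\sum_{k=0}^{n-1}\binom{n-1}{k}\,Y_k\big(-\psi(1),-\psi^{(1)}(1),\dots,-\psi^{(k-1)}(1)\big)\int_0^\infty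 \log^{n-k-1}v\;e^{-uv}\Big[\frac1{e^v-1}-\frac1v+\frac12\Big]dv .$$ (b) For every integer $n\ge1$, $$\gamma_n=(-1)^n\sum_{k=0}^{n}\binom nk\,Y_k\big(-\psi(1),-\psi^{(1)}(1),\dots,-\psi^{(k-1)}(1)\big)\int_0^\infty \log^{n-k}v\;e^{-v}\Big[\frac1{e^v-1}-\frac1v\Big]dv .$$ -/

import Mathlib

open Filter Topology Set MeasureTheory

/-- The Hurwitz zeta function `ζ(s, u)` for a real parameter `u > 0`. Mathlib's `hurwitzZeta`
depends on the parameter only modulo `1` and is `∑ 1 / (n + a) ^ s` with `a ∈ (0, 1]` congruent to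
`u`; here `a = u - m` with `m = ⌈u⌉₊ - 1`, and the first `m` terms of that series are removed.
See `hasSum_hurwitzZetaPos`, `differentiableAt_hurwitzZetaPos`. -/
noncomputable def hurwitzZetaPos (u : ℝ) (s : ℂ) : ℂ :=
  HurwitzZeta.hurwitzZeta (u : UnitAddCircle) s
    - ∑ j ∈ Finset.range (⌈u⌉₊ - 1), 1 / ((u : ℂ) - (j + 1)) ^ s

/-- The regular part `ζ(s, u) - 1 / (s - 1)` of the Hurwitz zeta function at its pole, with the
removable singularity at `s = 1` filled in by the limit. -/
noncomputable def hurwitzRegular (u : ℝ) : ℂ → ℂ :=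
  Function.update (fun s : ℂ => hurwitzZetaPos u s - 1 / (s - 1)) 1
    (limUnder (𝓝[≠] (1 : ℂ)) fun s : ℂ => hurwitzZetaPos u s - 1 / (s - 1))

/-- The generalised Stieltjes constants `γ_p(u)`: the coefficients in the Laurent expansion
`ζ(s, u) = 1 / (s - 1) + ∑ p, (-1) ^ p / p! * γ_p(u) * (s - 1) ^ p`
(see `hasSum_stieltjesConst`). -/
noncomputable def stieltjesConst (p : ℕ) (u : ℝ) : ℂ :=
  (-1) ^ p * iteratedDeriv p (hurwitzRegular u) 1

/-- The (exponential) complete Bell polynomial `Y_n(x_1, …, x_n)`, as the sum over all partitions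
of `n`; `k_j` is the number of parts equal to `j`, and the entry of `x` with index `i : Fin n`
is `x_{i+1}`. -/
noncomputable def completeBell (n : ℕ) (x : Fin n → ℂ) : ℂ :=
  ∑ π : n.Partition,
    (n.factorial : ℂ) / (∏ i : Fin n, ((π.parts.count (i.val + 1)).factorial : ℂ))
      * ∏ i : Fin n, (x i / ((i.val + 1).factorial : ℂ)) ^ π.parts.count (i.val + 1)

/-- `Y_k(-ψ(1), -ψ⁽¹⁾(1), …, -ψ⁽ᵏ⁻¹⁾(1))`, where `ψ` is the digamma function. -/
noncomputable def bellNegDigamma (k : ℕ) : ℂ :=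
  completeBell k fun i : Fin k => -iteratedDeriv i.val Complex.digamma 1

/-- For `Re s > 1`, `hurwitzZetaPos u s` is the sum of the usual Dirichlet series. -/
theorem hasSum_hurwitzZetaPos {u : ℝ} (hu : 0 < u) {s : ℂ} (hs : 1 < s.re) :
    HasSum (fun n : ℕ => 1 / ((n : ℂ) + u) ^ s) (hurwitzZetaPos u s) := by
  set m : ℕ := ⌈u⌉₊ - 1 with hm
  have hc : 0 < ⌈u⌉₊ := Nat.ceil_pos.2 hu
  have hm1 : m + 1 = ⌈u⌉₊ := by omega
  have h1 : u ≤ m + 1 := by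
    have := Nat.le_ceil u
    rw [← hm1] at this
    exact_mod_cast this
  have h2 : (m : ℝ) < u := Nat.lt_ceil.1 (by omega)
  have ha : u - m ∈ Icc (0 : ℝ) 1 := ⟨by linarith, by linarith⟩
  have key := HurwitzZeta.hasSum_hurwitzZeta_of_one_lt_re ha hs
  have hcirc : ((u - m : ℝ) : UnitAddCircle) = (u : UnitAddCircle) := by
    rw [AddCircle.coe_sub]
    have : ((m : ℝ) : UnitAddCircle) = 0 := by
      have := AddCircle.coe_eq_zero_iff (p := (1 : ℝ)) (x := (m : ℝ))
      exact this.2 ⟨m, by simp⟩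
    rw [this, sub_zero]
  rw [hcirc, ← hasSum_nat_add_iff' m] at key
  have hsum : ∑ i ∈ Finset.range m, 1 / ((i : ℂ) + ((u - m : ℝ) : ℂ)) ^ s
      = ∑ j ∈ Finset.range m, 1 / ((u : ℂ) - (j + 1)) ^ s := by
    rw [← Finset.sum_range_reflect]
    refine Finset.sum_congr rfl fun j hj => ?_
    have hj' : j + 1 ≤ m := by have := Finset.mem_range.1 hj; omega
    have : ((m - 1 - j : ℕ) : ℂ) = m - (j + 1) := by
      rw [Nat.sub_sub, Nat.add_comm 1 j, Nat.cast_sub hj']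
      push_cast
      ring
    rw [this]
    push_cast
    congr 2
    ring
  rw [hsum] at key
  refine key.congr_fun ?_
  intro n
  push_cast
  congr 2
  ring

/-- `hurwitzZetaPos u` is holomorphic away from `s = 1`. -/
theorem differentiableAt_hurwitzZetaPos {u : ℝ} {s : ℂ} (hs : s ≠ 1) :
    DifferentiableAt ℂ (hurwitzZetaPos u) s := by
  refine (HurwitzZeta.differentiableAt_hurwitzZeta _ hs).sub ?_
  refine DifferentiableAt.fun_sum fun j hj => ?_
  have hj' : j + 1 < ⌈u⌉₊ := by have := Finset.mem_range.1 hj; omega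
  have h0 : ((j : ℝ) + 1) < u := by exact_mod_cast Nat.lt_ceil.1 hj'
  have hne : (u : ℂ) - (j + 1) ≠ 0 := by
    have : u - (j + 1) ≠ 0 := by linarith
    exact_mod_cast this
  have hp : DifferentiableAt ℂ (fun z : ℂ => ((u : ℂ) - (j + 1)) ^ z) s :=
    differentiableAt_id.const_cpow (Or.inl hne)
  exact (differentiableAt_const _).div hp (by simp [Complex.cpow_eq_zero_iff, hne])

/-- `ζ(s, 1)` is the Riemann zeta function. -/
theorem hurwitzZetaPos_one : hurwitzZetaPos 1 = riemannZeta := by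
  ext s
  have : ((1 : ℝ) : UnitAddCircle) = 0 := AddCircle.coe_period 1
  simp [hurwitzZetaPos, this, HurwitzZeta.hurwitzZeta_zero]

/-- The regular part is an entire function. -/
theorem differentiable_hurwitzRegular (u : ℝ) :
    Differentiable ℂ (hurwitzRegular u) := by
  rw [← differentiableOn_univ]
  refine Complex.differentiableOn_update_limUnder_of_isLittleO univ_mem ?_ ?_
  · rintro s ⟨-, hs⟩
    have hs' : s ≠ 1 := hs
    refine ((differentiableAt_hurwitzZetaPos hs').sub ?_).differentiableWithinAt
    exact (differentiableAt_const _).div (by fun_prop) (sub_ne_zero.2 hs')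
  · set c : ℂ := hurwitzZetaPos u 1 - 1 / (1 - 1)
    have hres : Tendsto (fun s : ℂ => (s - 1) * hurwitzZetaPos u s) (𝓝[≠] 1) (𝓝 1) := by
      have h1 := HurwitzZeta.hurwitzZeta_residue_one (u : UnitAddCircle)
      have h2 : Tendsto (fun s : ℂ => (s - 1) *
          ∑ j ∈ Finset.range (⌈u⌉₊ - 1), 1 / ((u : ℂ) - (j + 1)) ^ s) (𝓝[≠] 1) (𝓝 0) := by
        have hcont : ContinuousAt (fun s : ℂ => (s - 1) *
            ∑ j ∈ Finset.range (⌈u⌉₊ - 1), 1 / ((u : ℂ) - (j + 1)) ^ s) 1 := by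
          refine ContinuousAt.mul (by fun_prop) (tendsto_finsetSum _ fun j hj => ?_)
          have hj' : j + 1 < ⌈u⌉₊ := by have := Finset.mem_range.1 hj; omega
          have h0 : ((j : ℝ) + 1) < u := by exact_mod_cast Nat.lt_ceil.1 hj'
          have hne : (u : ℂ) - (j + 1) ≠ 0 := by
            have : u - (j + 1) ≠ 0 := by linarith
            exact_mod_cast this
          exact ContinuousAt.div continuousAt_const
            (continuousAt_id.const_cpow (Or.inl hne)) (by simp [hne])
        have := hcont.tendsto.mono_left (nhdsWithin_le_nhds (s := {1}ᶜ))
        simpa using this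
      simpa [hurwitzZetaPos, mul_sub] using h1.sub h2
    refine (Asymptotics.isLittleO_iff_tendsto' ?_).2 ?_
    · filter_upwards [self_mem_nhdsWithin] with s hs h
      exact absurd (sub_eq_zero.1 (inv_eq_zero.1 h)) hs
    · have h3 : Tendsto (fun s : ℂ => (s - 1) * c) (𝓝[≠] 1) (𝓝 0) := by
        have : ContinuousAt (fun s : ℂ => (s - 1) * c) 1 := by fun_prop
        simpa using this.tendsto.mono_left (nhdsWithin_le_nhds (s := {1}ᶜ))
      have h4 := (hres.sub_const 1).sub h3
      rw [sub_self, sub_zero] at h4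
      refine h4.congr' ?_
      filter_upwards [self_mem_nhdsWithin] with s hs
      have hs' : s - 1 ≠ 0 := sub_ne_zero.2 hs
      field_simp

/-- The defining Laurent expansion of the Hurwitz zeta function about `s = 1`. -/
theorem hasSum_stieltjesConst (u : ℝ) {s : ℂ} (hs : s ≠ 1) :
    HasSum (fun p : ℕ => (-1) ^ p / (p.factorial : ℂ) * stieltjesConst p u * (s - 1) ^ p)
      (hurwitzZetaPos u s - 1 / (s - 1)) := by
  have h := Complex.hasSum_taylorSeries_of_entire (differentiable_hurwitzRegular u) 1 s
  have hv : hurwitzRegular u s = hurwitzZetaPos u s - 1 / (s - 1) := by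
    simp [hurwitzRegular, Function.update_of_ne hs]
  rw [hv] at h
  refine h.congr_fun ?_
  intro p
  have h1 : ((-1 : ℂ) ^ p) * (-1) ^ p = 1 := by rw [← mul_pow]; simp
  simp only [stieltjesConst, smul_eq_mul]
  linear_combination (iteratedDeriv p (hurwitzRegular u) 1 * (s - 1) ^ p / (p.factorial : ℂ)) * h1

/-! For `Re s > 1`, integrating a geometric series termwise shows that `Γ(s) ζ(s, u)` is the Mellin
transform of `e^(-uv) / (1 - e^(-v))`. Split `1 / (1 - e^(-v))` into the bounded bracket `1/(e^v -
1) - 1/v + 1/2`, plus `1/v`, plus `1/2`; the last two integrate to gamma functions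
(`Gamma_mul_hurwitzZetaPos`). With `M` the Mellin transform of the bracket times `e^(-uv)`, dividing
by `Γ(s)` gives `ζ(s, u) - 1/(s - 1) = (u^(1-s) - 1)/(s - 1) + u^(-s)/2 + M(s)/Γ(s)`, which the
identity theorem extends to `Re s > 0` (`sub_one_mul_hurwitzRemainder`).

Now differentiate `p` times at `s = 1`. The first two terms give the powers of `log u`. The third
expands by Leibniz: derivatives of `M` are integrals against powers of `log v`, and those of `1/Γ`
are Bell polynomials, because `(1/Γ)' = -ψ/Γ` produces their recurrence
(`iteratedDeriv_inv_Gamma_one`). For (b), put `u = 1`: dropping the `1/2` from the bracket changes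
the sum by half a derivative of `Γ/Γ = 1`, which is zero. -/

/-! ### Derivatives of Mellin transforms under an exponential bound -/

theorem isBigO_rpow_atTop_log_pow_smul {f : ℝ → ℂ} {u : ℝ} (hu : 0 < u)
    (hf : ∀ v ∈ Ioi (0 : ℝ), ‖f v‖ ≤ Real.exp (-(u * v))) (m : ℕ) (a : ℝ) :
    (fun v : ℝ => ((Real.log v ^ m : ℝ) : ℂ) * f v) =O[atTop] (fun v : ℝ => v ^ (-a)) := by
  induction m generalizing a with
  | zero =>
    have h1 : f =O[atTop] fun v : ℝ => Real.exp (-u * v) := by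
      refine Asymptotics.IsBigO.of_bound 1 ?_
      filter_upwards [Ioi_mem_atTop (0 : ℝ)] with v hv
      rw [one_mul, Real.norm_of_nonneg (Real.exp_pos _).le, neg_mul]
      exact hf v hv
    simpa using h1.trans (isLittleO_exp_neg_mul_rpow_atTop hu (-a)).isBigO
  | succ m ih =>
    refine (isBigO_rpow_top_log_smul (lt_add_one a) (ih (a + 1))).congr_left fun v => ?_
    rw [Complex.real_smul, pow_succ]
    push_cast
    ring

theorem isBigO_rpow_nhdsGT_zero_log_pow_smul {f : ℝ → ℂ} {u : ℝ} (hu : 0 < u)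
    (hf : ∀ v ∈ Ioi (0 : ℝ), ‖f v‖ ≤ Real.exp (-(u * v))) (m : ℕ) {b : ℝ} (hb : 0 < b) :
    (fun v : ℝ => ((Real.log v ^ m : ℝ) : ℂ) * f v) =O[𝓝[>] 0] (fun v : ℝ => v ^ (-b)) := by
  induction m generalizing b with
  | zero =>
    refine Asymptotics.IsBigO.of_bound 1 ?_
    filter_upwards [Ioo_mem_nhdsGT (zero_lt_one' ℝ)] with v hv
    have h1 : (1 : ℝ) ≤ v ^ (-b) :=
      Real.one_le_rpow_of_pos_of_le_one_of_nonpos hv.1 hv.2.le (by linarith)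
    have h2 : Real.exp (-(u * v)) ≤ 1 := Real.exp_le_one_iff.2 (by nlinarith [hv.1])
    rw [one_mul, Real.norm_of_nonneg (by linarith)]
    simpa using (hf v hv.1).trans (h2.trans h1)
  | succ m ih =>
    -- Each logarithm costs half of the exponent still available, hence the induction over all `b >
    -- 0`.
    refine (isBigO_rpow_zero_log_smul (half_lt_self hb) (ih (half_pos hb))).congr_left fun v => ?_
    rw [Complex.real_smul, pow_succ]
    push_cast
    ring

theorem continuousOn_log_pow_mul {f : ℝ → ℂ} (hf : ContinuousOn f (Ioi 0)) (m : ℕ) :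
    ContinuousOn (fun v : ℝ => ((Real.log v ^ m : ℝ) : ℂ) * f v) (Ioi 0) := by
  refine ContinuousOn.mul (Complex.continuous_ofReal.comp_continuousOn ?_) hf
  exact (Real.continuousOn_log.mono fun v hv => (ne_of_gt hv : v ≠ 0)).pow m

theorem mellinConvergent_log_pow_mul {f : ℝ → ℂ} {u : ℝ} (hu : 0 < u)
    (hc : ContinuousOn f (Ioi 0)) (hf : ∀ v ∈ Ioi (0 : ℝ), ‖f v‖ ≤ Real.exp (-(u * v)))
    (m : ℕ) {s : ℂ} (hs : 0 < s.re) :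
    MellinConvergent (fun v : ℝ => ((Real.log v ^ m : ℝ) : ℂ) * f v) s :=
  mellinConvergent_of_isBigO_rpow
    ((continuousOn_log_pow_mul hc m).locallyIntegrableOn measurableSet_Ioi)
    (isBigO_rpow_atTop_log_pow_smul hu hf m (s.re + 1)) (lt_add_one _)
    (isBigO_rpow_nhdsGT_zero_log_pow_smul hu hf m (half_pos hs)) (half_lt_self hs)

theorem hasDerivAt_mellin_log_pow_mul {f : ℝ → ℂ} {u : ℝ} (hu : 0 < u)
    (hc : ContinuousOn f (Ioi 0)) (hf : ∀ v ∈ Ioi (0 : ℝ), ‖f v‖ ≤ Real.exp (-(u * v)))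
    (m : ℕ) {s : ℂ} (hs : 0 < s.re) :
    HasDerivAt (mellin fun v : ℝ => ((Real.log v ^ m : ℝ) : ℂ) * f v)
      (mellin (fun v : ℝ => ((Real.log v ^ (m + 1) : ℝ) : ℂ) * f v) s) s := by
  have h := (mellin_hasDerivAt_of_isBigO_rpow
    ((continuousOn_log_pow_mul hc m).locallyIntegrableOn measurableSet_Ioi)
    (isBigO_rpow_atTop_log_pow_smul hu hf m (s.re + 1)) (lt_add_one _)
    (isBigO_rpow_nhdsGT_zero_log_pow_smul hu hf m (half_pos hs)) (half_lt_self hs)).2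
  have heq : (fun v : ℝ => ((Real.log v ^ (m + 1) : ℝ) : ℂ) * f v) =
      fun v : ℝ => Real.log v • (((Real.log v ^ m : ℝ) : ℂ) * f v) := by
    funext v
    rw [Complex.real_smul, pow_succ]
    push_cast
    ring
  rwa [heq]

theorem iteratedDeriv_mellin {f : ℝ → ℂ} {u : ℝ} (hu : 0 < u)
    (hc : ContinuousOn f (Ioi 0)) (hf : ∀ v ∈ Ioi (0 : ℝ), ‖f v‖ ≤ Real.exp (-(u * v)))
    (m : ℕ) {s : ℂ} (hs : 0 < s.re) :
    iteratedDeriv m (mellin f) s = mellin (fun v : ℝ => ((Real.log v ^ m : ℝ) : ℂ) * f v) s := by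
  induction m generalizing s with
  | zero => simp
  | succ m ih =>
    rw [iteratedDeriv_succ, ← (hasDerivAt_mellin_log_pow_mul hu hc hf m hs).deriv]
    refine Filter.EventuallyEq.deriv_eq ?_
    filter_upwards [(isOpen_lt continuous_const Complex.continuous_re).mem_nhds hs] with z hz
    exact ih hz

theorem differentiableOn_mellin {f : ℝ → ℂ} {u : ℝ} (hu : 0 < u)
    (hc : ContinuousOn f (Ioi 0)) (hf : ∀ v ∈ Ioi (0 : ℝ), ‖f v‖ ≤ Real.exp (-(u * v))) :
    DifferentiableOn ℂ (mellin f) {s | 0 < s.re} := fun s hs => by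
  have h := hasDerivAt_mellin_log_pow_mul hu hc hf 0 (s := s) hs
  simp only [pow_zero, Complex.ofReal_one, one_mul] at h
  exact h.differentiableAt.differentiableWithinAt

theorem integrableOn_log_pow_mul {f : ℝ → ℝ} {u : ℝ} (hu : 0 < u)
    (hc : ContinuousOn f (Ioi 0)) (hf : ∀ v ∈ Ioi (0 : ℝ), |f v| ≤ Real.exp (-(u * v)))
    (m : ℕ) : IntegrableOn (fun v : ℝ => Real.log v ^ m * f v) (Ioi 0) := by
  have h := mellinConvergent_log_pow_mul (f := fun v => (f v : ℂ)) hu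
    (Complex.continuous_ofReal.comp_continuousOn hc) (fun v hv => by simpa using hf v hv) m
    (s := 1) (by simp)
  refine IntegrableOn.congr_fun (f := fun v => (((Real.log v ^ m : ℝ) : ℂ) * f v).re) ?_
    (fun v _ => by simp only [← Complex.ofReal_mul, Complex.ofReal_re]) measurableSet_Ioi
  have h' := Integrable.re h
  simp only [sub_self, Complex.cpow_zero, one_smul, RCLike.re_eq_complex_re] at h'
  exact h'

theorem iteratedDeriv_mellin_ofReal_one {f : ℝ → ℝ} {u : ℝ} (hu : 0 < u)
    (hc : ContinuousOn f (Ioi 0)) (hf : ∀ v ∈ Ioi (0 : ℝ), |f v| ≤ Real.exp (-(u * v)))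
    (m : ℕ) : iteratedDeriv m (mellin fun v => (f v : ℂ)) 1 =
      ((∫ v in Ioi (0 : ℝ), Real.log v ^ m * f v : ℝ) : ℂ) := by
  rw [iteratedDeriv_mellin (f := fun v => (f v : ℂ)) hu (Complex.continuous_ofReal.comp_continuousOn hc)
    (fun v hv => by simpa using hf v hv) m (by simp), mellin, ← integral_complex_ofReal]
  simp

/-! ### The kernel and its bound -/

/-- The function `e ^ (-u v) (1 / (e ^ v - 1) - 1 / v + 1 / 2)`, whose Mellin transform gives the
Hurwitz zeta function up to elementary terms. -/
noncomputable def binetKernel (u v : ℝ) : ℝ :=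
  Real.exp (-(u * v)) * (1 / (Real.exp v - 1) - 1 / v + 1 / 2)

theorem continuousOn_binetKernel (u : ℝ) : ContinuousOn (binetKernel u) (Ioi 0) := by
  unfold binetKernel
  refine ContinuousOn.mul (by fun_prop) (ContinuousOn.add (ContinuousOn.sub ?_ ?_) (by fun_prop))
  · refine ContinuousOn.div (by fun_prop) (by fun_prop) fun v hv => ?_
    have : 1 < Real.exp v := Real.one_lt_exp_iff.2 hv
    linarith
  · exact ContinuousOn.div (by fun_prop) (by fun_prop) fun v hv => (ne_of_gt hv)

/-- The inequalities `e^v ≥ 1 + v` and `e^(-v) ≥ 1 - v` give `0 ≤ 1/v - 1/(e^v - 1) ≤ 1`, so the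
bracket lies in `[-1/2, 1/2]`. -/
theorem abs_binetKernel_le {u v : ℝ} (hv : v ∈ Ioi (0 : ℝ)) :
    |binetKernel u v| ≤ Real.exp (-(u * v)) := by
  have hv' : 0 < v := hv
  have h1 : v + 1 ≤ Real.exp v := Real.add_one_le_exp v
  have hE : 0 < Real.exp v - 1 := by linarith
  have h2 : 1 / (Real.exp v - 1) ≤ 1 / v := one_div_le_one_div_of_le hv' (by linarith)
  have h3 : 1 / v - 1 / (Real.exp v - 1) ≤ 1 := by
    rw [div_sub_div _ _ hv'.ne' hE.ne', div_le_one (by positivity)]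
    have h4 : -v + 1 ≤ Real.exp (-v) := Real.add_one_le_exp (-v)
    have h5 : Real.exp v * Real.exp (-v) = 1 := by rw [← Real.exp_add]; simp
    nlinarith [Real.exp_pos v]
  rw [binetKernel, abs_mul, abs_of_pos (Real.exp_pos _)]
  refine mul_le_of_le_one_right (Real.exp_pos _).le ?_
  rw [abs_le]
  constructor <;> linarith

/-! ### Complete Bell polynomials and their recurrence -/

/-- The product over the distinct parts `j` of `y j ^ c / c!`, where `c` is the multiplicity of
`j`. -/
noncomputable def bellWeight (y : ℕ → ℂ) (p : Multiset ℕ) : ℂ :=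
  ∏ j ∈ p.toFinset, y j ^ p.count j / ((p.count j).factorial : ℂ)

theorem bellWeight_eq_prod {y : ℕ → ℂ} {p : Multiset ℕ} {t : Finset ℕ} (h : p.toFinset ⊆ t) :
    bellWeight y p = ∏ j ∈ t, y j ^ p.count j / ((p.count j).factorial : ℂ) :=
  Finset.prod_subset h fun j _ hj => by
    simp [Multiset.count_eq_zero.2 fun hm => hj (Multiset.mem_toFinset.2 hm)]

/-- Only the factor at `i` changes: `(c + 1) y^(c+1) / (c+1)! = y · y^c / c!`. -/
theorem count_mul_bellWeight_cons (y : ℕ → ℂ) (i : ℕ) (p : Multiset ℕ) :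
    ((i ::ₘ p).count i : ℂ) * bellWeight y (i ::ₘ p) = y i * bellWeight y p := by
  have hi : i ∈ (i ::ₘ p).toFinset := by simp
  rw [bellWeight, bellWeight_eq_prod (t := (i ::ₘ p).toFinset) (by simp),
    ← Finset.mul_prod_erase _ _ hi, ← Finset.mul_prod_erase _ _ hi]
  have : ∏ j ∈ (i ::ₘ p).toFinset.erase i,
      y j ^ (i ::ₘ p).count j / (((i ::ₘ p).count j).factorial : ℂ) =
      ∏ j ∈ (i ::ₘ p).toFinset.erase i, y j ^ p.count j / ((p.count j).factorial : ℂ) :=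
    Finset.prod_congr rfl fun j hj => by
      rw [Multiset.count_cons_of_ne (Finset.ne_of_mem_erase hj)]
  rw [this, Multiset.count_cons_self, Nat.factorial_succ, ← mul_assoc, ← mul_assoc]
  congr 1
  have h1 : ((p.count i : ℂ) + 1) ≠ 0 := Nat.cast_add_one_ne_zero _
  have h2 : ((p.count i).factorial : ℂ) ≠ 0 := by exact_mod_cast Nat.factorial_ne_zero _
  push_cast
  field_simp
  ring

/-- The sum of the weights of all partitions of `n`. -/
noncomputable def bellSum (y : ℕ → ℂ) (n : ℕ) : ℂ := ∑ π : n.Partition, bellWeight y π.parts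

/-- Removing a part `i` from a partition of `n + i` gives a partition of `n`. -/
theorem sum_count_mul_bellWeight (y : ℕ → ℂ) (n : ℕ) {i : ℕ} (hi : 0 < i) :
    ∑ π : (n + i).Partition, (π.parts.count i : ℂ) * bellWeight y π.parts = y i * bellSum y n := by
  rw [bellSum, Finset.mul_sum]
  symm
  refine Finset.sum_of_injOn (fun π : n.Partition => (⟨i ::ₘ π.parts, fun {j} hj => by
      rcases Multiset.mem_cons.1 hj with rfl | hj
      · exact hi
      · exact π.parts_pos hj, by simp [π.parts_sum, add_comm]⟩ : (n + i).Partition)) ?_ ?_ ?_ ?_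
  · intro π _ π' _ h
    exact Nat.Partition.ext ((Multiset.cons_inj_right i).1 (congrArg Nat.Partition.parts h))
  · intro π _
    simp
  · intro π _ hπ
    -- A partition outside the image has no part `i`, so its term vanishes.
    have : i ∉ π.parts := fun hm => hπ ⟨⟨π.parts.erase i,
      fun {j} hj => π.parts_pos (Multiset.mem_of_mem_erase hj), by
        have h := π.parts_sum
        rw [← Multiset.cons_erase hm, Multiset.sum_cons] at h
        omega⟩, by simp, Nat.Partition.ext (Multiset.cons_erase hm)⟩
    simp [Multiset.count_eq_zero.2 this]
  · intro π _
    exact (count_mul_bellWeight_cons y i π.parts).symm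

/-- Write `n + 1` as the sum of `j · count j` over the parts of each partition, then exchange the
two sums. -/
theorem mul_bellSum (y : ℕ → ℂ) (n : ℕ) :
    ((n + 1 : ℕ) : ℂ) * bellSum y (n + 1) =
      ∑ i ∈ Finset.range (n + 1), ((i + 1 : ℕ) : ℂ) * y (i + 1) * bellSum y (n - i) := by
  have h1 : ∀ i ∈ Finset.range (n + 1), ((i + 1 : ℕ) : ℂ) * y (i + 1) * bellSum y (n - i) =
      ∑ π : (n + 1).Partition, ((i + 1 : ℕ) : ℂ) * (π.parts.count (i + 1) : ℂ)
        * bellWeight y π.parts := by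
    intro i hi
    obtain ⟨k, rfl⟩ := Nat.exists_eq_add_of_le (Finset.mem_range_succ_iff.1 hi)
    have := sum_count_mul_bellWeight y k (Nat.succ_pos i)
    rw [mul_assoc, Nat.add_sub_cancel_left, ← this, Finset.mul_sum,
      show i + k + 1 = k + i.succ by omega]
    exact Finset.sum_congr rfl fun π _ => (mul_assoc _ _ _).symm
  rw [Finset.sum_congr rfl h1, Finset.sum_comm, bellSum, Finset.mul_sum]
  refine Finset.sum_congr rfl fun π _ => ?_
  rw [← Finset.sum_mul]
  congr 1
  have h2 : π.parts.toFinset ⊆ Finset.range (n + 2) := fun j hj =>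
    Finset.mem_range_succ_iff.2 (π.le_of_mem_parts (Multiset.mem_toFinset.1 hj))
  have h3 : n + 1 = ∑ j ∈ Finset.range (n + 2), j * π.parts.count j := by
    conv_lhs => rw [← π.parts_sum, Finset.sum_multiset_count]
    rw [Finset.sum_subset h2 fun j _ hj => by
      simp [Multiset.count_eq_zero.2 fun hm => hj (Multiset.mem_toFinset.2 hm)]]
    exact Finset.sum_congr rfl fun j _ => by rw [smul_eq_mul, mul_comm]
  rw [Finset.sum_range_succ', zero_mul, add_zero] at h3
  exact_mod_cast congrArg (Nat.cast : ℕ → ℂ) h3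

/-- Parts are counted from 1 and entries from 0, hence `x (j - 1)`; the junk value at `j = 0` is
harmless because no part is zero. -/
theorem completeBell_eq_bellSum (n : ℕ) (x : ℕ → ℂ) :
    completeBell n (fun i => x i.val) =
      (n.factorial : ℂ) * bellSum (fun j => x (j - 1) / (j.factorial : ℂ)) n := by
  rw [completeBell, bellSum, Finset.mul_sum]
  refine Finset.sum_congr rfl fun π _ => ?_
  have h : π.parts.toFinset ⊆ Finset.range (n + 1) := fun j hj =>
    Finset.mem_range_succ_iff.2 (π.le_of_mem_parts (Multiset.mem_toFinset.1 hj))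
  have h0 : π.parts.count 0 = 0 := Multiset.count_eq_zero.2 fun hm => (π.parts_pos hm).false
  rw [bellWeight_eq_prod h, Finset.prod_range_succ', h0, Finset.prod_div_distrib,
    ← Fin.prod_univ_eq_prod_range (fun i => ((π.parts.count (i + 1)).factorial : ℂ)),
    ← Fin.prod_univ_eq_prod_range
      (fun i => (x (i + 1 - 1) / ((i + 1).factorial : ℂ)) ^ π.parts.count (i + 1))]
  simp only [Nat.add_sub_cancel, pow_zero, Nat.factorial_zero, Nat.cast_one, div_one, mul_one]
  ring

theorem completeBell_zero (x : Fin 0 → ℂ) : completeBell 0 x = 1 := by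
  simp [completeBell]

/-- The recurrence for the complete Bell polynomials. -/
theorem completeBell_succ (n : ℕ) (x : ℕ → ℂ) :
    completeBell (n + 1) (fun i => x i.val) =
      ∑ i ∈ Finset.range (n + 1), (n.choose i : ℂ) * x i *
        completeBell (n - i) (fun i => x i.val) := by
  rw [completeBell_eq_bellSum, Nat.factorial_succ, Nat.cast_mul, mul_comm ((n + 1 : ℕ) : ℂ),
    mul_assoc, mul_bellSum, Finset.mul_sum]
  refine Finset.sum_congr rfl fun i hi => ?_
  have hi' : i ≤ n := Finset.mem_range_succ_iff.1 hi
  rw [completeBell_eq_bellSum, ← Nat.choose_mul_factorial_mul_factorial hi', Nat.factorial_succ,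
    Nat.add_sub_cancel]
  have h1 : (i.factorial : ℂ) ≠ 0 := by exact_mod_cast Nat.factorial_ne_zero _
  have h2 : (i : ℂ) + 1 ≠ 0 := Nat.cast_add_one_ne_zero _
  push_cast
  field_simp

/-! ### Derivatives of `1/Γ` at 1 -/

/-- Leibniz applied to `(1/Γ)' = -ψ · (1/Γ)` is exactly the recurrence `completeBell_succ`. -/
theorem iteratedDeriv_inv_Gamma_one (k : ℕ) :
    iteratedDeriv k (fun s => (Complex.Gamma s)⁻¹) 1 = bellNegDigamma k := by
  set g : ℂ → ℂ := fun s => (Complex.Gamma s)⁻¹ with hg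
  have hU : IsOpen {s : ℂ | 0 < s.re} := isOpen_lt continuous_const Complex.continuous_re
  have h1U : (1 : ℂ) ∈ {s : ℂ | 0 < s.re} := by simp
  have hd : ∀ s ∈ {s : ℂ | 0 < s.re}, DifferentiableAt ℂ Complex.Gamma s := fun s hs =>
    Complex.differentiableAt_Gamma s fun m h => by
      have : 0 < s.re := hs
      rw [h] at this
      simp at this
      have := Nat.cast_nonneg (α := ℝ) m
      linarith
  have hΓ : ∀ s ∈ {s : ℂ | 0 < s.re}, Complex.Gamma s ≠ 0 := fun s hs =>
    Complex.Gamma_ne_zero_of_re_pos hs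
  have hga : ContDiff ℂ ⊤ g := Complex.differentiable_one_div_Gamma.contDiff
  have hΓo : DifferentiableOn ℂ Complex.Gamma {s : ℂ | 0 < s.re} := fun s hs =>
    (hd s hs).differentiableWithinAt
  have hψ : ContDiffAt ℂ ⊤ (fun s => -Complex.digamma s) 1 := by
    refine DifferentiableOn.contDiffOn (s := {s : ℂ | 0 < s.re}) ?_ hU |>.contDiffAt
      (hU.mem_nhds h1U)
    exact ((hΓo.deriv hU).div hΓo hΓ).neg
  have hderiv : deriv g =ᶠ[𝓝 1] (fun s => -Complex.digamma s) * g := by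
    filter_upwards [hU.mem_nhds h1U] with s hs
    rw [hg, deriv_fun_inv'' (hd s hs) (hΓ s hs), Pi.mul_apply, Complex.digamma_def, logDeriv_apply]
    have := hΓ s hs
    field_simp
  induction k using Nat.strong_induction_on with
  | _ k ih =>
    cases k with
    | zero => simp [bellNegDigamma, completeBell_zero, hg]
    | succ n =>
      rw [iteratedDeriv_succ', hderiv.iteratedDeriv_eq n,
        iteratedDeriv_mul (hψ.of_le le_top) (hga.contDiffAt.of_le le_top), bellNegDigamma,
        completeBell_succ n (fun i => -iteratedDeriv i Complex.digamma 1)]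
      refine Finset.sum_congr rfl fun i hi => ?_
      rw [ih (n - i) (by omega), iteratedDeriv_fun_neg, bellNegDigamma]

/-! ### Mellin representation of the Hurwitz zeta function -/

theorem isOpen_re_pos : IsOpen {s : ℂ | 0 < s.re} :=
  isOpen_lt continuous_const Complex.continuous_re

theorem mellin_exp_neg_mul {u : ℝ} (hu : 0 < u) {s : ℂ} (hs : 0 < s.re) :
    mellin (fun v : ℝ => ((Real.exp (-(u * v)) : ℝ) : ℂ)) s =
      Complex.Gamma s * Complex.exp (-Real.log u * s) := by
  have h := mellin_comp_mul_left (fun v : ℝ => ((Real.exp (-v) : ℝ) : ℂ)) s hu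
  rw [h, ← Complex.GammaIntegral_eq_mellin, ← Complex.Gamma_eq_integral hs, smul_eq_mul, mul_comm,
    Complex.cpow_def_of_ne_zero (by exact_mod_cast hu.ne'), Complex.ofReal_log hu.le]
  ring_nf

theorem continuous_ofReal_exp_neg_mul (u : ℝ) :
    Continuous fun v : ℝ => ((Real.exp (-(u * v)) : ℝ) : ℂ) := by
  fun_prop

theorem norm_ofReal_exp_le (x : ℝ) : ‖((Real.exp x : ℝ) : ℂ)‖ ≤ Real.exp x := by
  simp

theorem mellinConvergent_of_norm_le_exp {f : ℝ → ℂ} {u : ℝ} (hu : 0 < u)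
    (hc : ContinuousOn f (Ioi 0)) (hf : ∀ v ∈ Ioi (0 : ℝ), ‖f v‖ ≤ Real.exp (-(u * v)))
    {s : ℂ} (hs : 0 < s.re) : MellinConvergent f s := by
  simpa using mellinConvergent_log_pow_mul hu hc hf 0 hs

/-- A geometric series with `1/(1 - e^(-v)) = 1/(e^v - 1) + 1`. The coefficient `1` and the factor
`v ^ (-1)` are shaped for `hasSum_mellin` and `mellin_cpow_smul`. -/
theorem hasSum_exp_neg_mul {u v : ℝ} (hv : 0 < v) :
    HasSum (fun n : ℕ => (1 : ℂ) * ((Real.exp (-((n : ℝ) + u) * v) : ℝ) : ℂ))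
      ((binetKernel u v : ℂ) + ((v : ℂ) ^ (-1 : ℂ) • ((Real.exp (-(u * v)) : ℝ) : ℂ)
        + (1 / 2 : ℂ) • ((Real.exp (-(u * v)) : ℝ) : ℂ))) := by
  have hlt : Real.exp (-v) < 1 := Real.exp_lt_one_iff.2 (neg_lt_zero.2 hv)
  have h := (hasSum_geometric_of_lt_one (Real.exp_pos (-v)).le hlt).mul_left (Real.exp (-(u * v)))
  have h1 : 1 < Real.exp v := Real.one_lt_exp_iff.2 hv
  have h2 : Real.exp v - 1 ≠ 0 := by linarith
  have h3 : Real.exp (-(u * v)) * (1 - Real.exp (-v))⁻¹ =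
      binetKernel u v + (v⁻¹ * Real.exp (-(u * v)) + 1 / 2 * Real.exp (-(u * v))) := by
    have h4 : (1 - Real.exp (-v))⁻¹ = 1 / (Real.exp v - 1) + 1 := by
      rw [Real.exp_neg]
      have : (1 - (Real.exp v)⁻¹) ≠ 0 := by
        rw [← Real.exp_neg]
        linarith
      field_simp
      ring
    rw [h4, binetKernel]
    ring
  rw [h3] at h
  have h5 := Complex.hasSum_ofReal.2 h
  rw [Complex.cpow_neg_one]
  convert h5 using 1
  · funext n
    rw [one_mul, ← Real.exp_nat_mul, ← Real.exp_add]
    ring_nf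
  · simp only [smul_eq_mul]
    push_cast
    ring

theorem Gamma_mul_hurwitzZetaPos {u : ℝ} (hu : 0 < u) {s : ℂ} (hs : 1 < s.re) :
    Complex.Gamma s * hurwitzZetaPos u s =
      mellin (fun v => (binetKernel u v : ℂ)) s
      + (Complex.Gamma (s - 1) * Complex.exp (-Real.log u * (s - 1))
        + 1 / 2 * (Complex.Gamma s * Complex.exp (-Real.log u * s))) := by
  have hs0 : 0 < s.re := by linarith
  have hs1 : 0 < (s + -1).re := by simpa using hs
  have hpos : ∀ n : ℕ, 0 < (n : ℝ) + u := fun n => by positivity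
  have hz := hasSum_hurwitzZetaPos hu hs
  have hsum : Summable fun n : ℕ => ‖(1 : ℂ)‖ / ((n : ℝ) + u) ^ s.re := by
    refine hz.summable.norm.congr fun n => ?_
    rw [norm_div, ← Complex.norm_cpow_eq_rpow_re_of_pos (hpos n)]
    push_cast
    rfl
  have key := hasSum_mellin (a := fun _ : ℕ => (1 : ℂ)) (p := fun n : ℕ => (n : ℝ) + u)
    (fun n => Or.inr (hpos n)) hs0 (fun v hv => hasSum_exp_neg_mul hv) hsum
  have hz' : HasSum (fun n : ℕ => Complex.Gamma s * 1 / (((n : ℝ) + u : ℝ) : ℂ) ^ s)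
      (Complex.Gamma s * hurwitzZetaPos u s) := by
    refine (hz.mul_left (Complex.Gamma s)).congr_fun fun n => ?_
    push_cast
    ring
  rw [hz'.unique key]
  have c1 : MellinConvergent (fun v => (binetKernel u v : ℂ)) s :=
    mellinConvergent_of_norm_le_exp hu
      (Complex.continuous_ofReal.comp_continuousOn (continuousOn_binetKernel u))
      (fun v hv => by simpa using abs_binetKernel_le hv) hs0
  have cE : ∀ {z : ℂ}, 0 < z.re →
      MellinConvergent (fun v : ℝ => ((Real.exp (-(u * v)) : ℝ) : ℂ)) z := fun hz =>
    mellinConvergent_of_norm_le_exp hu (continuous_ofReal_exp_neg_mul u).continuousOn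
      (fun v _ => norm_ofReal_exp_le _) hz
  have c2 := MellinConvergent.cpow_smul.2 (cE hs1)
  have c3 := (cE hs0).const_smul (1 / 2 : ℂ)
  rw [(hasMellin_add c1 (hasMellin_add c2 c3).1).2, (hasMellin_add c2 c3).2, mellin_cpow_smul,
    mellin_const_smul, mellin_exp_neg_mul hu hs0, mellin_exp_neg_mul hu hs1, smul_eq_mul,
    ← sub_eq_add_neg]

/-! ### Continuation to `Re s > 0` -/

theorem hurwitzRegular_of_ne {u : ℝ} {s : ℂ} (hs : s ≠ 1) :
    hurwitzRegular u s = hurwitzZetaPos u s - 1 / (s - 1) := by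
  simp [hurwitzRegular, Function.update_of_ne hs]

theorem differentiable_inv_Gamma : Differentiable ℂ fun s => (Complex.Gamma s)⁻¹ :=
  Complex.differentiable_one_div_Gamma

theorem differentiableOn_mellin_binetKernel {u : ℝ} (hu : 0 < u) :
    DifferentiableOn ℂ (mellin fun v => (binetKernel u v : ℂ)) {s | 0 < s.re} :=
  differentiableOn_mellin hu
    (Complex.continuous_ofReal.comp_continuousOn (continuousOn_binetKernel u))
    (fun v hv => by simpa using abs_binetKernel_le hv)

/-- What is left of the regular part of the Hurwitz zeta function after removing the term
`u ^ (-s) / 2` and the Mellin transform. -/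
noncomputable def hurwitzRemainder (u : ℝ) (s : ℂ) : ℂ :=
  hurwitzRegular u s - 1 / 2 * Complex.exp (-Real.log u * s)
    - (Complex.Gamma s)⁻¹ * mellin (fun v => (binetKernel u v : ℂ)) s

theorem differentiableOn_hurwitzRemainder {u : ℝ} (hu : 0 < u) :
    DifferentiableOn ℂ (hurwitzRemainder u) {s | 0 < s.re} := by
  refine DifferentiableOn.sub (DifferentiableOn.sub ?_ ?_) (DifferentiableOn.mul ?_ ?_)
  · exact (differentiable_hurwitzRegular u).differentiableOn
  · fun_prop
  · exact differentiable_inv_Gamma.differentiableOn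
  · exact differentiableOn_mellin_binetKernel hu

/-- For `Re s > 1` this is the Mellin representation together with `Γ(s) = (s - 1) Γ(s - 1)`; both
sides are analytic on the half-plane. The factor `s - 1` avoids a quotient at `s = 1`. -/
theorem sub_one_mul_hurwitzRemainder {u : ℝ} (hu : 0 < u) :
    EqOn (fun s => (s - 1) * hurwitzRemainder u s)
      (fun s => Complex.exp (-Real.log u * (s - 1)) - 1) {s | 0 < s.re} := by
  have hf : AnalyticOnNhd ℂ (fun s => (s - 1) * hurwitzRemainder u s) {s | 0 < s.re} :=
    (DifferentiableOn.mul (by fun_prop) (differentiableOn_hurwitzRemainder hu)).analyticOnNhd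
      isOpen_re_pos
  have hg : AnalyticOnNhd ℂ (fun s => Complex.exp (-Real.log u * (s - 1)) - 1) {s | 0 < s.re} :=
    DifferentiableOn.analyticOnNhd (by fun_prop) isOpen_re_pos
  have hconn : IsPreconnected {s : ℂ | 0 < s.re} := (convex_halfSpace_re_gt 0).isPreconnected
  refine hf.eqOn_of_preconnected_of_eventuallyEq hg hconn (z₀ := 2) (by simp) ?_
  have hmem : {s : ℂ | 1 < s.re} ∈ 𝓝 (2 : ℂ) :=
    (isOpen_lt continuous_const Complex.continuous_re).mem_nhds (by simp)
  filter_upwards [hmem] with s hs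
  have hs' : 1 < s.re := hs
  have hne : s ≠ 1 := fun h => by simp [h] at hs'
  have hne' : s - 1 ≠ 0 := sub_ne_zero.2 hne
  have hΓ : Complex.Gamma s ≠ 0 := Complex.Gamma_ne_zero_of_re_pos (by linarith)
  have hΓ1 : Complex.Gamma s = (s - 1) * Complex.Gamma (s - 1) := by
    rw [← Complex.Gamma_add_one _ hne', sub_add_cancel]
  have key := Gamma_mul_hurwitzZetaPos hu hs'
  rw [hurwitzRemainder, hurwitzRegular_of_ne hne]
  have h2 : mellin (fun v => (binetKernel u v : ℂ)) s = Complex.Gamma s * hurwitzZetaPos u s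
      - (Complex.Gamma s / (s - 1) * Complex.exp (-Real.log u * (s - 1))
        + 1 / 2 * (Complex.Gamma s * Complex.exp (-Real.log u * s))) := by
    rw [key]
    have : Complex.Gamma s / (s - 1) = Complex.Gamma (s - 1) := by
      rw [hΓ1]
      field_simp
    rw [this]
    ring
  rw [h2]
  field_simp
  ring

/-! ### Taylor coefficients at `s = 1` -/

/-- In the Leibniz sum only `i = 1` survives: `s - c` vanishes at `c`, and so do its derivatives of
order at least 2. -/
theorem iteratedDeriv_succ_sub_mul {A : ℂ → ℂ} {c : ℂ} (n : ℕ) (hA : ContDiffAt ℂ ⊤ A c) :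
    iteratedDeriv (n + 1) (fun s => (s - c) * A s) c = ((n : ℂ) + 1) * iteratedDeriv n A c := by
  have h := iteratedDeriv_mul (n := n + 1) (x := c) (f := fun s : ℂ => s - c) (g := A)
    (by fun_prop) (hA.of_le le_top)
  have hd : deriv (fun s : ℂ => s - c) = fun _ => 1 := by
    funext s
    simp
  change iteratedDeriv (n + 1) ((fun s : ℂ => s - c) * A) c = _
  rw [h, Finset.sum_eq_single 1]
  · rw [iteratedDeriv_one, hd]
    simp
  · intro i _ hi
    obtain rfl | ⟨j, rfl⟩ : i = 0 ∨ ∃ j, i = j + 2 := by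
      rcases i with _ | _ | j
      · exact Or.inl rfl
      · exact absurd rfl hi
      · exact Or.inr ⟨j, rfl⟩
    · simp
    · rw [iteratedDeriv_succ', hd, iteratedDeriv_const]
      simp
  · intro h
    exact absurd (Finset.mem_range.2 (by omega)) h

theorem iteratedDeriv_hurwitzRemainder_one {u : ℝ} (hu : 0 < u) (p : ℕ) :
    ((p : ℂ) + 1) * iteratedDeriv p (hurwitzRemainder u) 1 = (-Real.log u : ℂ) ^ (p + 1) := by
  have hmem : {s : ℂ | 0 < s.re} ∈ 𝓝 (1 : ℂ) := isOpen_re_pos.mem_nhds (by simp)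
  have hA : ContDiffAt ℂ ⊤ (hurwitzRemainder u) 1 :=
    ((differentiableOn_hurwitzRemainder hu).contDiffOn isOpen_re_pos).contDiffAt hmem
  rw [← iteratedDeriv_succ_sub_mul p hA,
    ((sub_one_mul_hurwitzRemainder hu).eventuallyEq_of_mem hmem).iteratedDeriv_eq,
    iteratedDeriv_comp_sub_const (p + 1) (fun z => Complex.exp (-Real.log u * z) - 1) 1]
  simp only [sub_self]
  -- The order is at least 1, so peeling off one derivative removes the constant `-1`.
  rw [iteratedDeriv_succ']
  have : deriv (fun z => Complex.exp (-Real.log u * z) - 1) =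
      deriv (fun z => Complex.exp (-Real.log u * z)) := by
    funext z
    rw [deriv_sub_const]
  rw [this, ← iteratedDeriv_succ', iteratedDeriv_cexp_const_mul]
  simp

/-- Stated for general `f` because it serves twice: for `binetKernel u`, and for `e^(-v)`, whose
Mellin transform is `Γ`. -/
theorem iteratedDeriv_inv_Gamma_mul_mellin {f : ℝ → ℝ} {u : ℝ} (hu : 0 < u)
    (hc : ContinuousOn f (Ioi 0)) (hf : ∀ v ∈ Ioi (0 : ℝ), |f v| ≤ Real.exp (-(u * v))) (p : ℕ) :
    iteratedDeriv p ((fun s => (Complex.Gamma s)⁻¹) * mellin fun v => (f v : ℂ)) 1 =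
      ∑ k ∈ Finset.range (p + 1), (p.choose k : ℂ) * bellNegDigamma k *
        ((∫ v in Ioi (0 : ℝ), Real.log v ^ (p - k) * f v : ℝ) : ℂ) := by
  have hmem : {s : ℂ | 0 < s.re} ∈ 𝓝 (1 : ℂ) := isOpen_re_pos.mem_nhds (by simp)
  have hF : ContDiffAt ℂ p (mellin fun v => (f v : ℂ)) 1 :=
    ((differentiableOn_mellin hu (Complex.continuous_ofReal.comp_continuousOn hc)
      (fun v hv => by simpa using hf v hv)).contDiffOn isOpen_re_pos).contDiffAt hmem
  rw [iteratedDeriv_mul differentiable_inv_Gamma.contDiff.contDiffAt hF]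
  refine Finset.sum_congr rfl fun k _ => ?_
  rw [iteratedDeriv_inv_Gamma_one, iteratedDeriv_mellin_ofReal_one hu hc hf]

theorem iteratedDeriv_hurwitzRegular_one {u : ℝ} (hu : 0 < u) (p : ℕ) :
    iteratedDeriv p (hurwitzRegular u) 1 =
      1 / (2 * u) * (-Real.log u : ℂ) ^ p + (-Real.log u : ℂ) ^ (p + 1) / ((p : ℂ) + 1)
      + ∑ k ∈ Finset.range (p + 1), (p.choose k : ℂ) * bellNegDigamma k *
        ((∫ v in Ioi (0 : ℝ), Real.log v ^ (p - k) * binetKernel u v : ℝ) : ℂ) := by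
  have hmem : {s : ℂ | 0 < s.re} ∈ 𝓝 (1 : ℂ) := isOpen_re_pos.mem_nhds (by simp)
  have hA : ContDiffAt ℂ p (hurwitzRemainder u) 1 :=
    ((differentiableOn_hurwitzRemainder hu).contDiffOn isOpen_re_pos).contDiffAt hmem
  have hE : ContDiffAt ℂ p (fun s : ℂ => 1 / 2 * Complex.exp (-Real.log u * s)) 1 := by fun_prop
  have hF : ContDiffAt ℂ p
      ((fun s => (Complex.Gamma s)⁻¹) * mellin fun v => (binetKernel u v : ℂ)) 1 :=
    ((differentiable_inv_Gamma.differentiableOn.mul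
      (differentiableOn_mellin_binetKernel hu)).contDiffOn isOpen_re_pos).contDiffAt hmem
  have hdecomp : hurwitzRegular u = hurwitzRemainder u
      + (fun s : ℂ => 1 / 2 * Complex.exp (-Real.log u * s))
      + ((fun s => (Complex.Gamma s)⁻¹) * mellin fun v => (binetKernel u v : ℂ)) := by
    funext s
    simp only [Pi.add_apply, Pi.mul_apply, hurwitzRemainder]
    ring
  have hp : (p : ℂ) + 1 ≠ 0 := Nat.cast_add_one_ne_zero p
  have hL : Complex.exp (-Real.log u) = 1 / u := by
    rw [← Complex.ofReal_neg, ← Complex.ofReal_exp, Real.exp_neg, Real.exp_log hu]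
    push_cast
    ring
  rw [hdecomp, iteratedDeriv_add (f := hurwitzRemainder u + _) (hA.add hE) hF,
    iteratedDeriv_add hA hE,
    iteratedDeriv_inv_Gamma_mul_mellin hu (continuousOn_binetKernel u)
      (fun v hv => abs_binetKernel_le hv),
    iteratedDeriv_const_mul_field, iteratedDeriv_cexp_const_mul,
    eq_div_of_mul_eq hp ((mul_comm _ _).trans (iteratedDeriv_hurwitzRemainder_one hu p))]
  simp only [mul_one, hL]
  field_simp
  ring

/-! ### The two formulas -/

theorem stieltjesConst_eq {u : ℝ} (hu : 0 < u) (p : ℕ) :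
    stieltjesConst p u =
      ((1 / (2 * u) * Real.log u ^ p - 1 / ((p + 1 : ℕ) : ℝ) * Real.log u ^ (p + 1) : ℝ) : ℂ)
      + (-1) ^ p * ∑ k ∈ Finset.range (p + 1), (p.choose k : ℂ) * bellNegDigamma k *
        ((∫ v in Ioi (0 : ℝ), Real.log v ^ (p - k) * binetKernel u v : ℝ) : ℂ) := by
  rw [stieltjesConst, iteratedDeriv_hurwitzRegular_one hu, neg_pow, neg_pow _ (p + 1), pow_succ]
  have h1 : ((-1 : ℂ) ^ p) * (-1) ^ p = 1 := by rw [← mul_pow]; simp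
  push_cast
  linear_combination (1 / (2 * u) * (Real.log u : ℂ) ^ p
    - (Real.log u : ℂ) ^ (p + 1) / ((p : ℂ) + 1)) * h1

/-- The derivatives of `1 / Γ` times `Γ` at `1`, by the Leibniz rule. -/
theorem sum_bellNegDigamma_mul_integral {n : ℕ} (hn : 1 ≤ n) :
    ∑ k ∈ Finset.range (n + 1), (n.choose k : ℂ) * bellNegDigamma k *
      ((∫ v in Ioi (0 : ℝ), Real.log v ^ (n - k) * Real.exp (-(1 * v)) : ℝ) : ℂ) = 0 := by
  rw [← iteratedDeriv_inv_Gamma_mul_mellin one_pos (by fun_prop)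
    (fun v _ => (abs_of_pos (Real.exp_pos _)).le)]
  have h : ((fun s => (Complex.Gamma s)⁻¹) *
      mellin fun v : ℝ => ((Real.exp (-(1 * v)) : ℝ) : ℂ)) =ᶠ[𝓝 1] fun _ => 1 := by
    filter_upwards [isOpen_re_pos.mem_nhds (show (1 : ℂ) ∈ {s : ℂ | 0 < s.re} by simp)] with s hs
    rw [Pi.mul_apply, mellin_exp_neg_mul one_pos hs]
    simp [Complex.Gamma_ne_zero_of_re_pos hs]
  rw [h.iteratedDeriv_eq, iteratedDeriv_const, if_neg (by omega)]

theorem binetKernel_one (v : ℝ) : binetKernel 1 v =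
    Real.exp (-v) * (1 / (Real.exp v - 1) - 1 / v) + 1 / 2 * Real.exp (-(1 * v)) := by
  rw [binetKernel, one_mul]
  ring

theorem integrableOn_log_pow_mul_binetKernel {u : ℝ} (hu : 0 < u) (m : ℕ) :
    IntegrableOn (fun v => Real.log v ^ m * binetKernel u v) (Ioi 0) :=
  integrableOn_log_pow_mul hu (continuousOn_binetKernel u) (fun _ hv => abs_binetKernel_le hv) m

theorem integrableOn_log_pow_mul_exp_neg (m : ℕ) :
    IntegrableOn (fun v => Real.log v ^ m * Real.exp (-(1 * v))) (Ioi 0) :=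
  integrableOn_log_pow_mul one_pos (by fun_prop) (fun _ _ => (abs_of_pos (Real.exp_pos _)).le) m

theorem log_pow_mul_binetKernel_one_sub (m : ℕ) (v : ℝ) :
    Real.log v ^ m * Real.exp (-v) * (1 / (Real.exp v - 1) - 1 / v) =
      Real.log v ^ m * binetKernel 1 v - 1 / 2 * (Real.log v ^ m * Real.exp (-(1 * v))) := by
  rw [binetKernel_one]
  ring

theorem mainTheorem1 :
    -- all the integrals converge (absolutely)
    ((∀ (m : ℕ) (u : ℝ), 0 < u →
        IntegrableOn (fun v : ℝ => Real.log v ^ m * Real.exp (-(u * v)) *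
          (1 / (Real.exp v - 1) - 1 / v + 1 / 2)) (Ioi 0)) ∧
      (∀ m : ℕ,
        IntegrableOn (fun v : ℝ => Real.log v ^ m * Real.exp (-v) *
          (1 / (Real.exp v - 1) - 1 / v)) (Ioi 0))) ∧
    (∀ (n : ℕ) (u : ℝ), 1 ≤ n → 0 < u →
      stieltjesConst (n - 1) u =
        ((1 / (2 * u) * Real.log u ^ (n - 1) - 1 / (n : ℝ) * Real.log u ^ n : ℝ) : ℂ) +
        (-1) ^ (n - 1) * ∑ k ∈ Finset.range n, ((n - 1).choose k : ℂ) * bellNegDigamma k *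
          ((∫ v in Ioi (0 : ℝ), Real.log v ^ (n - k - 1) * Real.exp (-(u * v)) *
            (1 / (Real.exp v - 1) - 1 / v + 1 / 2) : ℝ) : ℂ)) ∧
    (∀ n : ℕ, 1 ≤ n →
      stieltjesConst n 1 =
        (-1) ^ n * ∑ k ∈ Finset.range (n + 1), (n.choose k : ℂ) * bellNegDigamma k *
          ((∫ v in Ioi (0 : ℝ), Real.log v ^ (n - k) * Real.exp (-v) *
            (1 / (Real.exp v - 1) - 1 / v) : ℝ) : ℂ)) := by
  refine ⟨⟨fun m u hu => ?_, fun m => ?_⟩, fun n u hn hu => ?_, fun n hn => ?_⟩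
  · simpa only [binetKernel, ← mul_assoc] using integrableOn_log_pow_mul_binetKernel hu m
  · simp_rw [log_pow_mul_binetKernel_one_sub]
    exact (integrableOn_log_pow_mul_binetKernel one_pos m).sub
      ((integrableOn_log_pow_mul_exp_neg m).const_mul (1 / 2))
  · obtain ⟨p, rfl⟩ := Nat.exists_eq_add_of_le' hn
    rw [Nat.add_sub_cancel, stieltjesConst_eq hu]
    congr 2
    refine Finset.sum_congr rfl fun k _ => ?_
    rw [show p + 1 - k - 1 = p - k by omega]
    simp only [binetKernel, ← mul_assoc]
  · have h : ∀ m : ℕ, ((∫ v in Ioi (0 : ℝ), Real.log v ^ m * Real.exp (-v) *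
        (1 / (Real.exp v - 1) - 1 / v) : ℝ) : ℂ) =
        ((∫ v in Ioi (0 : ℝ), Real.log v ^ m * binetKernel 1 v : ℝ) : ℂ) -
        1 / 2 * ((∫ v in Ioi (0 : ℝ), Real.log v ^ m * Real.exp (-(1 * v)) : ℝ) : ℂ) := fun m => by
      simp_rw [log_pow_mul_binetKernel_one_sub]
      rw [integral_sub (integrableOn_log_pow_mul_binetKernel one_pos m)
        ((integrableOn_log_pow_mul_exp_neg m).const_mul (1 / 2)), integral_const_mul]
      push_cast
      rfl
    have h0 : (1 : ℂ) / 2 * ∑ k ∈ Finset.range (n + 1), (n.choose k : ℂ) * bellNegDigamma k *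
        ((∫ v in Ioi (0 : ℝ), Real.log v ^ (n - k) * Real.exp (-(1 * v)) : ℝ) : ℂ) = 0 := by
      rw [sum_bellNegDigamma_mul_integral hn, mul_zero]
    -- As `n ≥ 1`, both powers of `log 1` vanish. The vanishing sum `h0` is then subtracted, turning
    -- each kernel integral into the one without `1/2`.
    rw [stieltjesConst_eq one_pos, Real.log_one, zero_pow (by omega), zero_pow (by omega),
      ← sub_zero (∑ k ∈ Finset.range (n + 1), (n.choose k : ℂ) * bellNegDigamma k *
        ((∫ v in Ioi (0 : ℝ), Real.log v ^ (n - k) * binetKernel 1 v : ℝ) : ℂ)), ← h0,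
      Finset.mul_sum, ← Finset.sum_sub_distrib]
    simp only [mul_zero, sub_zero, Complex.ofReal_zero, zero_add]
    congr 1
    refine Finset.sum_congr rfl fun k _ => ?_
    rw [h]
    ring
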